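/- For $n\ge 1$ let $\lambda(n)=(n-1,n-2,\ldots,1)$ denote the staircase partition. For a partition $\mu$, padded by zeros to $n$ entries, let $s_\mu$ be the Schur polynomial in $n$ variables, i.e. the quotient $$s_\mu(q_1,\ldots,q_n)=\frac{a_{\mu+\lambda(n)}(q_1,\ldots,q_n)}{a_{\lambda(n)}(q_1,\ldots,q_n)},\qquad a_\mu(q_1,\ldots,q_n)=\det\bigl(q_i^{\mu_j}\bigr)_{1\le i,j\le n},$$ where $\lambda(n)$ is read as $(n-1,n-2,\ldots,1,0)$. This quotient is a polynomial with integer coefficients and is therefore defined also when some of the $q_i$ coincide. Let $m\ge 0$ be an integer, let $w\in\mathbb{C}$ with $w\neq 0$ and $w+w^{-1}\neq 0$, and let $$\mathbf q=(\underbrace{w,\ldots,w}_{m+1},\underbrace{w^{-1},\ldots,w^{-1}}_{m+1})$$ be of length $2m+2$. Then $s_{\lambda(2m+3)}(\mathbf q)\neq 0$ and $$\frac{s_{\lambda(2m+1)}(\mathbf q)}{s_{\lambda(2m+3)}(\mathbf q)}=2^{-2m}\sum_{k=0}^{m}\binom{2k}{k}\binom{2m-k}{m}\frac{1}{(w+w^{-1})^{2k+1}}.$$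 -/

import Mathlib

open MvPolynomial

/-- The alternant `a_μ = det (X_i ^ {μ_j})_{i,j}` in the variables `X_0, …, X_{n-1}`,
as a polynomial with integer coefficients. -/
noncomputable def alternant {n : ℕ} (μ : Fin n → ℕ) : MvPolynomial (Fin n) ℤ :=
  Matrix.det (Matrix.of fun i j : Fin n => (X i : MvPolynomial (Fin n) ℤ) ^ μ j)

/-- The staircase partition `λ(k) = (k-1, k-2, …, 1)`, padded by zeros to an exponent vector
with `n` entries (here `k ≤ n + 1`, so that no part is lost). The entries are indexed from `0`,
and the truncated subtraction produces exactly the padding zeros. -/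
def staircase (n k : ℕ) : Fin n → ℕ := fun j => k - 1 - (j : ℕ)

/-- Substituting `X_j` for `X_i`. -/
noncomputable def identifyVars {n : ℕ} (i j : Fin n) :
    MvPolynomial (Fin n) ℤ →ₐ[ℤ] MvPolynomial (Fin n) ℤ :=
  aeval (fun l => if l = i then X j else X l)

theorem X_sub_X_dvd_iff {n : ℕ} (i j : Fin n) (p : MvPolynomial (Fin n) ℤ) :
    (X i - X j) ∣ p ↔ identifyVars i j p = 0 := by
  constructor
  · rintro ⟨c, rfl⟩
    by_cases h : j = i <;> simp [identifyVars, h]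
  · intro hp
    let I : Ideal (MvPolynomial (Fin n) ℤ) := Ideal.span {X i - X j}
    have key : (Ideal.Quotient.mkₐ ℤ I).comp (identifyVars i j) = Ideal.Quotient.mkₐ ℤ I := by
      apply MvPolynomial.algHom_ext
      intro l
      by_cases h : l = i
      · subst h
        simp only [identifyVars, AlgHom.comp_apply, aeval_X, if_true, Ideal.Quotient.mkₐ_eq_mk]
        symm
        rw [Ideal.Quotient.eq]
        exact Ideal.subset_span rfl
      · simp [identifyVars, h]
    have h1 := DFunLike.congr_fun key p
    rw [AlgHom.comp_apply, hp, map_zero] at h1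
    rw [← Ideal.mem_span_singleton]
    exact Ideal.Quotient.eq_zero_iff_mem.mp h1.symm

theorem prime_X_sub_X {n : ℕ} {i j : Fin n} (hij : i ≠ j) :
    Prime (X i - X j : MvPolynomial (Fin n) ℤ) := by
  refine ⟨?_, ?_, ?_⟩
  · rw [sub_ne_zero]
    exact fun h => hij (MvPolynomial.X_injective h)
  · intro hu
    have h := (X_sub_X_dvd_iff i j 1).mp hu.dvd
    simp at h
  · intro a b hab
    rw [X_sub_X_dvd_iff, map_mul, mul_eq_zero] at hab
    rwa [X_sub_X_dvd_iff, X_sub_X_dvd_iff]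

theorem X_sub_X_dvd_alternant {n : ℕ} {i j : Fin n} (hij : i ≠ j) (μ : Fin n → ℕ) :
    (X i - X j) ∣ alternant μ := by
  rw [X_sub_X_dvd_iff, alternant, AlgHom.map_det]
  apply Matrix.det_zero_of_row_eq hij
  funext l
  by_cases h : j = i <;> simp [identifyVars, h]

theorem vandermonde_dvd_alternant {n : ℕ} (μ : Fin n → ℕ) :
    (Matrix.vandermonde (X : Fin n → MvPolynomial (Fin n) ℤ)).det ∣ alternant μ := by
  rw [Matrix.det_vandermonde, Finset.prod_sigma']
  apply Finset.prod_dvd_of_isRelPrime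
  · rintro ⟨a, b⟩ hab ⟨c, d⟩ hcd hne
    simp only [Finset.coe_sigma, Set.mem_sigma_iff, Finset.coe_Ioi, Set.mem_Ioi] at hab hcd
    have h1 : b ≠ a := ne_of_gt hab.2
    refine ((prime_X_sub_X h1).irreducible.isRelPrime_iff_not_dvd).mpr ?_
    intro h
    rw [X_sub_X_dvd_iff] at h
    have hlt : a < b := hab.2
    have hlt' : c < d := hcd.2
    simp only [identifyVars, map_sub, aeval_X, sub_eq_zero] at h
    apply hne
    split_ifs at h with h2 h3 h3
    · omega
    · have := MvPolynomial.X_injective h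
      subst h2 this
      rfl
    · have := MvPolynomial.X_injective h
      omega
    · have := MvPolynomial.X_injective h
      omega
  · rintro ⟨a, b⟩ hab
    simp only [Finset.mem_sigma, Finset.mem_Ioi] at hab
    exact X_sub_X_dvd_alternant (ne_of_gt hab.2) μ

theorem associated_alternant_staircase (n : ℕ) :
    Associated (Matrix.vandermonde (X : Fin n → MvPolynomial (Fin n) ℤ)).det
      (alternant (staircase n n)) := by
  have h : (Matrix.of fun i j : Fin n => (X i : MvPolynomial (Fin n) ℤ) ^ staircase n n j)
      = (Matrix.vandermonde (X : Fin n → MvPolynomial (Fin n) ℤ)).submatrix id Fin.revPerm := by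
    ext1 i j
    simp only [Matrix.of_apply, Matrix.submatrix_apply, Matrix.vandermonde_apply, staircase, id,
      Fin.revPerm_apply, Fin.val_rev]
    congr 1
    omega
  rw [alternant, h, Matrix.det_permute']
  rcases Int.units_eq_one_or (Equiv.Perm.sign (Fin.revPerm (n := n))) with h | h <;>
    simp [h]

theorem alternant_staircase_ne_zero (n : ℕ) : alternant (staircase n n) ≠ 0 := by
  rw [← (associated_alternant_staircase n).ne_zero_iff, Matrix.det_vandermonde_ne_zero_iff]
  exact MvPolynomial.X_injective

theorem alternant_staircase_dvd {n : ℕ} (μ : Fin n → ℕ) :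
    alternant (staircase n n) ∣ alternant μ :=
  (associated_alternant_staircase n).dvd_iff_dvd_left.mp (vandermonde_dvd_alternant μ)

/-- The Schur polynomial `s_μ = a_{μ + λ(n)} / a_{λ(n)}` in `n` variables: the exact quotient in
the polynomial ring `ℤ[X_0, …, X_{n-1}]`. It exists by `alternant_staircase_dvd` and is
characterized by `schurPoly_mul` and `schurPoly_unique`. -/
noncomputable def schurPoly {n : ℕ} (μ : Fin n → ℕ) : MvPolynomial (Fin n) ℤ :=
  Classical.choose (alternant_staircase_dvd (μ + staircase n n))

theorem schurPoly_mul {n : ℕ} (μ : Fin n → ℕ) :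
    schurPoly μ * alternant (staircase n n) = alternant (μ + staircase n n) := by
  rw [mul_comm]
  exact (Classical.choose_spec (alternant_staircase_dvd (μ + staircase n n))).symm

theorem schurPoly_unique {n : ℕ} (μ : Fin n → ℕ) (p : MvPolynomial (Fin n) ℤ)
    (hp : p * alternant (staircase n n) = alternant (μ + staircase n n)) : p = schurPoly μ :=
  mul_right_cancel₀ (alternant_staircase_ne_zero n) (hp.trans (schurPoly_mul μ).symm)

/-- The value `s_μ(q)` of the Schur polynomial at a point `q` (with possibly equal entries). -/
noncomputable def schur {n : ℕ} (μ : Fin n → ℕ) (q : Fin n → ℂ) : ℂ :=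
  aeval q (schurPoly μ)

/-- The tuple `(w, …, w, w⁻¹, …, w⁻¹)` with `m + 1` copies of `w` and `m + 1` copies of `w⁻¹`. -/
noncomputable def quarticTuple (m : ℕ) (w : ℂ) : Fin (2 * m + 2) → ℂ :=
  fun i => if (i : ℕ) < m + 1 then w else w⁻¹

/-! Let `z` be the class of `X` in `B = ℂ[X] / ∏ (X - q_i)`. An alternant is the Vandermonde
determinant times the determinant of the remainders of its powers modulo `∏ (X - q_i)`. Cancelling
the Vandermonde factor for indeterminate nodes and then specializing expresses Schur values by
remainders, even at repeated nodes.

In `2m + 2` variables, `λ(2m+3)` gives the exponents `4m+3, 4m+1, …, 1`, and `λ(2m+1)` gives `4m+1,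
…, 1, 0`. The second determinant arises from the first by replacing `z ^ (4m+3)` with `1` and
rotating the rows, with sign `-1`. So the ratio is the `r` for which `1 + r z ^ (4m+3)` lies in the
span of `z, z ^ 3, …, z ^ (4m+1)` (`det_staircase_eq_mul`).

To find `r`, put `y = z + z⁻¹` and `t = w + w⁻¹`, so that `(y - t) ^ (m+1) = 0`. With `U_k` the
polynomials `signedFib`, `1 = z ^ (2m+1) U_{2m+1}(y) - z ^ (2m+2) U_{2m}(y)`. If `p` has degree at
most `m`, then `z ^ (2m+1) p(y²)` lies in the span, and so does `z ^ (2m+2) y p(y²)` up to its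
leading coefficient times `z ^ (4m+3)`. The binomial series for `y⁻¹ = t⁻¹ (1 + (y² - t²) / t²) ^
(-1/2)` brings both terms into these forms, and its coefficients give `r` as `topCoeff`
(`one_add_topCoeff_smul_mem_oddSpan`); `topCoeff_eq` evaluates it. -/

/-! ### Schur values as determinants of remainders -/

/-- The monic polynomial `∏ (X - q_i)` with prescribed roots. -/
noncomputable def nodePoly {n : ℕ} {R : Type*} [CommRing R] (q : Fin n → R) : Polynomial R :=
  ∏ i, (Polynomial.X - Polynomial.C (q i))

theorem nodePoly_monic {n : ℕ} {R : Type*} [CommRing R] (q : Fin n → R) : (nodePoly q).Monic :=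
  Polynomial.monic_prod_of_monic _ _ fun i _ => Polynomial.monic_X_sub_C (q i)

theorem nodePoly_map {n : ℕ} {R S : Type*} [CommRing R] [CommRing S] (f : R →+* S)
    (q : Fin n → R) : (nodePoly q).map f = nodePoly fun i => f (q i) := by
  simp [nodePoly, Polynomial.map_prod]

/-- The coefficients of the remainders of the powers `X ^ e_j` modulo `∏ (X - q_i)`. -/
noncomputable def powRemMatrix {n : ℕ} {R : Type*} [CommRing R] (q : Fin n → R) (e : Fin n → ℕ) :
    Matrix (Fin n) (Fin n) R :=
  Matrix.of fun j k => ((Polynomial.X ^ e j : Polynomial R) %ₘ nodePoly q).coeff k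

theorem powRemMatrix_map {n : ℕ} {R S : Type*} [CommRing R] [CommRing S] (f : R →+* S)
    (q : Fin n → R) (e : Fin n → ℕ) :
    (powRemMatrix q e).map f = powRemMatrix (fun i => f (q i)) e := by
  ext j k
  simp only [powRemMatrix, Matrix.map_apply, Matrix.of_apply]
  rw [← Polynomial.coeff_map, Polynomial.map_modByMonic f (nodePoly_monic q), nodePoly_map]
  simp

/-- Evaluating at a root `q i` does not see multiples of `nodePoly q`, so each power may be replaced
by its remainder, which has degree below `n`. -/
theorem det_pow_eq_det_vandermonde_mul {n : ℕ} {R : Type*} [CommRing R] [Nontrivial R]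
    (q : Fin n → R) (e : Fin n → ℕ) :
    (Matrix.of fun i j => q i ^ e j).det =
      (Matrix.vandermonde q).det * (powRemMatrix q e).det := by
  rw [← Matrix.det_transpose (powRemMatrix q e), ← Matrix.det_mul]
  congr 1
  ext i j
  have hdeg : (nodePoly q).natDegree = n := by
    simp [nodePoly]
  have hroot : (nodePoly q).eval (q i) = 0 := by
    rw [nodePoly, Polynomial.eval_prod]
    exact Finset.prod_eq_zero (Finset.mem_univ i) (by simp)
  have hne : nodePoly q ≠ 1 := by
    intro h
    simp [h] at hroot
  have hlt := Polynomial.natDegree_modByMonic_lt (Polynomial.X ^ e j) (nodePoly_monic q) hne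
  rw [hdeg] at hlt
  have h1 : q i ^ e j = ((Polynomial.X ^ e j : Polynomial R) %ₘ nodePoly q).eval (q i) := by
    conv_lhs => rw [← Polynomial.eval_X_pow (x := q i) (n := e j),
      ← Polynomial.modByMonic_add_div (Polynomial.X ^ e j : Polynomial R) (nodePoly q)]
    simp [hroot]
  rw [Matrix.of_apply, h1, Polynomial.eval_eq_sum_range' hlt, Matrix.mul_apply,
    ← Fin.sum_univ_eq_sum_range (fun k =>
      ((Polynomial.X ^ e j : Polynomial R) %ₘ nodePoly q).coeff k * q i ^ k)]
  simp [powRemMatrix, Matrix.vandermonde_apply, mul_comm]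

/-- Up to a factor depending only on the number of variables, the value of a Schur polynomial is
a determinant of remainders modulo `∏ (X - q_i)`, also when some of the `q_i` coincide. -/
theorem exists_schur_mul_eq_det_powRemMatrix {n : ℕ} (q : Fin n → ℂ) :
    ∃ c : ℂ, c ≠ 0 ∧ ∀ μ : Fin n → ℕ,
      schur μ q * c = (powRemMatrix q (μ + staircase n n)).det := by
  obtain ⟨u, hu⟩ := associated_alternant_staircase n
  refine ⟨aeval q (u : MvPolynomial (Fin n) ℤ), (u.isUnit.map (aeval q)).ne_zero, fun μ => ?_⟩
  have hV : (Matrix.vandermonde (X : Fin n → MvPolynomial (Fin n) ℤ)).det ≠ 0 := by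
    rw [Matrix.det_vandermonde_ne_zero_iff]
    exact MvPolynomial.X_injective
  have h : schurPoly μ * u =
      (powRemMatrix (X : Fin n → MvPolynomial (Fin n) ℤ) (μ + staircase n n)).det := by
    -- The cancellation takes place for indeterminate nodes, where the Vandermonde determinant is
    -- nonzero; at `q` itself it may vanish.
    apply mul_left_cancel₀ hV
    rw [← det_pow_eq_det_vandermonde_mul]
    change _ = alternant (μ + staircase n n)
    rw [← schurPoly_mul, ← hu]
    ring
  rw [schur, ← map_mul, h, ← AlgHom.coe_toRingHom, RingHom.map_det, RingHom.mapMatrix_apply,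
    powRemMatrix_map]
  simp

/-! ### Nonvanishing of the denominator -/

theorem staircase_succ_add_staircase (n : ℕ) (j : Fin n) :
    (staircase n (n + 1) + staircase n n) j = 2 * staircase n n j + 1 := by
  have := j.2
  simp only [staircase, Pi.add_apply]
  omega

/-- `s_{(n, n-1, …, 1)}` does not vanish where `∏ q_i ∏_{i<j} (q_i + q_j)` does not vanish. -/
theorem schur_staircase_succ_ne_zero {n : ℕ} (q : Fin n → ℂ) (h0 : ∀ i, q i ≠ 0)
    (hadd : ∀ i j, q i + q j ≠ 0) : schur (staircase n (n + 1)) q ≠ 0 := by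
  obtain ⟨u, hu⟩ := associated_alternant_staircase n
  let φ : MvPolynomial (Fin n) ℤ →ₐ[ℤ] MvPolynomial (Fin n) ℤ := aeval fun i => X i ^ 2
  let W : MvPolynomial (Fin n) ℤ := ∏ i : Fin n, ∏ j ∈ Finset.Ioi i, (X j + X i)
  have hV : (Matrix.vandermonde (X : Fin n → MvPolynomial (Fin n) ℤ)).det ≠ 0 := by
    rw [Matrix.det_vandermonde_ne_zero_iff]
    exact MvPolynomial.X_injective
  have hφV : φ (Matrix.vandermonde (X : Fin n → MvPolynomial (Fin n) ℤ)).det =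
      (Matrix.vandermonde (X : Fin n → MvPolynomial (Fin n) ℤ)).det * W := by
    simp only [Matrix.det_vandermonde, map_prod, map_sub, φ, aeval_X, W, ← Finset.prod_mul_distrib]
    refine Finset.prod_congr rfl fun i _ => Finset.prod_congr rfl fun j _ => ?_
    ring
  -- The exponents are `2 λ_j + 1`: one factor `X i` leaves each row, and the rest is the staircase
  -- alternant in the squares.
  have halt : alternant (staircase n (n + 1) + staircase n n) =
      (∏ i, X i) * φ (alternant (staircase n n)) := by
    rw [alternant, alternant, AlgHom.map_det, ← Matrix.det_mul_column]
    congr 1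
    ext1 i j
    rw [Matrix.of_apply, staircase_succ_add_staircase]
    simp only [φ, AlgHom.mapMatrix_apply, Matrix.of_apply, Matrix.map_apply, map_pow, aeval_X]
    ring
  have h : schurPoly (staircase n (n + 1)) * (u : MvPolynomial (Fin n) ℤ) =
      (∏ i, X i) * W * φ u := by
    apply mul_left_cancel₀ hV
    have := schurPoly_mul (staircase n (n + 1))
    rw [halt, ← hu, map_mul, hφV] at this
    linear_combination this
  have h' := congrArg (aeval q) h
  intro hs
  rw [schur] at hs
  rw [map_mul, hs, zero_mul] at h'
  refine absurd h'.symm ?_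
  rw [map_mul, map_mul]
  refine mul_ne_zero (mul_ne_zero ?_ ?_) ((u.isUnit.map φ).map (aeval q)).ne_zero
  · simpa [Finset.prod_ne_zero_iff] using h0
  · simp only [W, map_prod, map_add, aeval_X, Finset.prod_ne_zero_iff]
    exact fun i _ j _ => hadd j i

/-! ### Laurent expansions and Chebyshev-type polynomials -/

section Laurent

variable {B : Type*} [CommRing B]

theorem pow_mul_add_inv_pow {z z' : B} (hz : z * z' = 1) {a b : ℕ} (hab : b ≤ a) :
    z ^ a * (z + z') ^ b = ∑ i ∈ Finset.range (b + 1), z ^ (a - b + 2 * i) * (b.choose i : B) := by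
  rw [add_pow, Finset.mul_sum]
  refine Finset.sum_congr rfl fun i hi => ?_
  have hi : i ≤ b := by simpa [Nat.lt_succ_iff] using hi
  have h1 : a = (a - b + i) + (b - i) := by omega
  have h2 : z ^ (b - i) * z' ^ (b - i) = 1 := by rw [← mul_pow, hz, one_pow]
  calc z ^ a * (z ^ i * z' ^ (b - i) * (b.choose i : B))
      = z ^ ((a - b + i) + (b - i)) * (z ^ i * z' ^ (b - i) * (b.choose i : B)) := by rw [← h1]
    _ = z ^ (a - b + i) * z ^ i * (b.choose i : B) * (z ^ (b - i) * z' ^ (b - i)) := by ring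
    _ = _ := by rw [h2, ← pow_add, mul_one, add_assoc, two_mul]

/-- The signed Fibonacci polynomial `∑ (-1) ^ j * (k - j).choose j * y ^ (k - 2 j)`, that is the
rescaled Chebyshev polynomial of the second kind. -/
def signedFib (y : B) (k : ℕ) : B :=
  ∑ p ∈ Finset.HasAntidiagonal.antidiagonal k, (-1) ^ p.1 * (p.2.choose p.1 : B) * y ^ (p.2 - p.1)

theorem signedFib_zero (y : B) : signedFib y 0 = 1 := by simp [signedFib]

theorem signedFib_one (y : B) : signedFib y 1 = y := by
  simp [signedFib, Finset.Nat.antidiagonal_succ]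

theorem signedFib_add_two (y : B) (k : ℕ) :
    signedFib y (k + 2) = y * signedFib y (k + 1) - signedFib y k := by
  simp only [signedFib]
  rw [Finset.Nat.antidiagonal_succ_succ', Finset.Nat.antidiagonal_succ]
  simp only [Finset.sum_cons, Finset.sum_map, Function.Embedding.prodMap,
    Function.Embedding.coeFn_mk, Prod.map_fst, Prod.map_snd, Function.Embedding.refl_apply, mul_add,
    Finset.mul_sum, Nat.choose_zero_succ, Nat.choose_zero_right, Nat.succ_eq_add_one]
  rw [add_comm, add_sub_assoc, ← Finset.sum_sub_distrib]
  have : ∀ p ∈ Finset.HasAntidiagonal.antidiagonal k,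
      (-1 : B) ^ (p.1 + 1) * ((p.2 + 1).choose (p.1 + 1) : B) * y ^ (p.2 + 1 - (p.1 + 1)) =
      y * ((-1) ^ (p.1 + 1) * (p.2.choose (p.1 + 1) : B) * y ^ (p.2 - (p.1 + 1))) -
        (-1) ^ p.1 * (p.2.choose p.1 : B) * y ^ (p.2 - p.1) := by
    rintro ⟨i, j⟩ -
    simp only [Nat.choose_succ_succ, Nat.add_sub_add_right]
    rcases Nat.lt_or_ge i j with h | h
    · have : j - i = (j - (i + 1)) + 1 := by omega
      rw [this]
      push_cast
      ring
    · rw [Nat.choose_eq_zero_of_lt (by omega : j < i + 1)]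
      push_cast
      ring
  rw [← Finset.sum_congr rfl this]
  simp only [Nat.cast_zero, mul_zero, zero_mul, zero_add, Nat.sub_zero,
    Nat.cast_one, pow_zero, one_mul]
  rw [← pow_succ']
  exact add_comm _ _

/-- Since `z'` is a root of `X² - (z + z') X + 1`, its powers satisfy the recursion of `signedFib`.
-/
theorem inv_pow_eq_signedFib {z z' : B} (hz : z * z' = 1) (k : ℕ) :
    z' ^ (k + 2) = signedFib (z + z') (k + 1) * z' - signedFib (z + z') k := by
  induction k with
  | zero =>
    rw [zero_add, zero_add, signedFib_one, signedFib_zero]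
    linear_combination -hz
  | succ k ih =>
    rw [pow_succ, ih, signedFib_add_two]
    linear_combination -(signedFib (z + z') (k + 1)) * hz

theorem signedFib_two_mul (y : B) (m : ℕ) :
    signedFib y (2 * m) = ∑ k ∈ Finset.range (m + 1),
      (-1) ^ k * ((2 * m - k).choose k : B) * (y ^ 2) ^ (m - k) := by
  rw [signedFib, Finset.Nat.sum_antidiagonal_eq_sum_range_succ_mk]
  symm
  apply Finset.sum_subset_zero_on_sdiff
  · exact Finset.range_subset_range.mpr (by omega)
  · intro k hk
    simp only [Finset.mem_sdiff, Finset.mem_range] at hk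
    rw [Nat.choose_eq_zero_of_lt (by omega)]
    simp
  · intro k hk
    simp only [Finset.mem_range] at hk
    rw [← pow_mul]
    congr 2
    omega

theorem exists_signedFib_eq_aeval_sq [Algebra ℂ B] (y : B) (m : ℕ) :
    (∃ p : Polynomial ℂ, signedFib y (2 * m) = Polynomial.aeval (y ^ 2) p) ∧
      ∃ p : Polynomial ℂ, signedFib y (2 * m + 1) = y * Polynomial.aeval (y ^ 2) p := by
  induction m with
  | zero => exact ⟨⟨1, by simp [signedFib_zero]⟩, ⟨1, by simp [signedFib_one]⟩⟩
  | succ m ih =>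
    obtain ⟨⟨p, hp⟩, r, hr⟩ := ih
    have h1 : signedFib y (2 * (m + 1)) = Polynomial.aeval (y ^ 2) (Polynomial.X * r - p) := by
      rw [mul_add, mul_one, signedFib_add_two, hp, hr, map_sub, map_mul, Polynomial.aeval_X]
      ring
    refine ⟨⟨_, h1⟩, Polynomial.X * r - p - r, ?_⟩
    rw [show 2 * (m + 1) + 1 = 2 * m + 1 + 2 by ring, signedFib_add_two,
      show 2 * m + 1 + 1 = 2 * (m + 1) by ring, h1, hr, map_sub _ _ r]
    ring

end Laurent

/-! ### Binomial series at nilpotent elements -/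

section Nilpotent

variable {B : Type*} [CommRing B] [Algebra ℂ B]

/-- Evaluation of a power series at an element whose `M`-th power vanishes. -/
noncomputable def evalTrunc (M : ℕ) (x : B) (f : PowerSeries ℂ) : B :=
  Polynomial.aeval x (f.trunc M)

theorem evalTrunc_coe {M : ℕ} {x : B} (hx : x ^ M = 0) (p : Polynomial ℂ) :
    evalTrunc M x (p : PowerSeries ℂ) = Polynomial.aeval x p := by
  have h : Polynomial.X ^ M ∣ p - PowerSeries.trunc M (p : PowerSeries ℂ) := by
    rw [Polynomial.X_pow_dvd_iff]
    intro d hd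
    simp [PowerSeries.coeff_trunc, hd]
  obtain ⟨c, hc⟩ := h
  have := congrArg (Polynomial.aeval x) hc
  rw [map_mul, map_pow, Polynomial.aeval_X, hx, zero_mul, map_sub, sub_eq_zero] at this
  exact this.symm

/-- The terms lost by truncation are divisible by `X ^ M`, which vanishes at `x`. -/
theorem evalTrunc_mul {M : ℕ} {x : B} (hx : x ^ M = 0) (f g : PowerSeries ℂ) :
    evalTrunc M x (f * g) = evalTrunc M x f * evalTrunc M x g := by
  rw [evalTrunc, ← PowerSeries.trunc_trunc_mul_trunc, ← Polynomial.coe_mul]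
  exact (evalTrunc_coe hx _).trans (map_mul _ _ _)

/-- The power `(1 + x / T) ^ r` at a nilpotent `x`. -/
noncomputable def nilBinom (M : ℕ) (x : B) (T r : ℂ) : B :=
  evalTrunc M x (PowerSeries.rescale T⁻¹ (PowerSeries.binomialSeries ℂ r))

theorem nilBinom_add {M : ℕ} {x : B} (hx : x ^ M = 0) (T r s : ℂ) :
    nilBinom M x T (r + s) = nilBinom M x T r * nilBinom M x T s := by
  rw [nilBinom, PowerSeries.binomialSeries_add, map_mul, evalTrunc_mul hx]
  rfl

theorem nilBinom_natCast {M : ℕ} {x : B} (hx : x ^ M = 0) (T : ℂ) (k : ℕ) :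
    nilBinom M x T k = (1 + T⁻¹ • x) ^ k := by
  have h : PowerSeries.rescale T⁻¹ (PowerSeries.binomialSeries ℂ (k : ℂ)) =
      (((1 + Polynomial.C T⁻¹ * Polynomial.X) ^ k : Polynomial ℂ) : PowerSeries ℂ) := by
    simp [PowerSeries.rescale_X]
  rw [nilBinom, h, evalTrunc_coe hx]
  simp [Algebra.smul_def]

theorem nilBinom_eq_sum (m : ℕ) (x : B) (T r : ℂ) :
    nilBinom (m + 1) x T r =
      ∑ i ∈ Finset.range (m + 1), (Ring.choose r i * (T⁻¹) ^ i) • x ^ i := by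
  rw [nilBinom, evalTrunc,
    Polynomial.aeval_eq_sum_range' (PowerSeries.natDegree_trunc_lt _ m)]
  refine Finset.sum_congr rfl fun i hi => ?_
  rw [PowerSeries.coeff_trunc, if_pos (Finset.mem_range.mp hi)]
  simp [PowerSeries.coeff_rescale, mul_comm]

theorem isNilpotent_nilBinom_sub_one {m : ℕ} {x : B} (hx : x ^ (m + 1) = 0) (T r : ℂ) :
    IsNilpotent (nilBinom (m + 1) x T r - 1) := by
  rw [nilBinom_eq_sum, Finset.sum_range_succ']
  simp only [pow_zero, Ring.choose_zero_right, mul_one, one_smul, add_sub_cancel_right]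
  refine isNilpotent_sum fun i _ => IsNilpotent.smul ?_ _
  rw [pow_succ]
  exact Commute.isNilpotent_mul_left (Commute.all _ _) ⟨m + 1, hx⟩

/-- `y⁻¹ = t⁻¹ (1 + (y ^ 2 - t ^ 2) / t ^ 2) ^ (-1/2)` for `y` infinitesimally close to `t`. -/
theorem mul_nilBinom_neg_half_eq_one {m : ℕ} {y : B} {t : ℂ} (ht : t ≠ 0)
    (hy : (y - algebraMap ℂ B t) ^ (m + 1) = 0) :
    y * (t⁻¹ • nilBinom (m + 1) (y ^ 2 - algebraMap ℂ B (t ^ 2)) (t ^ 2) (-1 / 2)) = 1 := by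
  set x := y ^ 2 - algebraMap ℂ B (t ^ 2) with hx_def
  have hx : x ^ (m + 1) = 0 := by
    have : x = (y - algebraMap ℂ B t) * (y + algebraMap ℂ B t) := by
      rw [hx_def, map_pow]; ring
    rw [this, mul_pow, hy, zero_mul]
  set e := nilBinom (m + 1) x (t ^ 2) (-1 / 2) with he
  set τ := algebraMap ℂ B t⁻¹ with hτ
  have hτt : τ * algebraMap ℂ B t = 1 := by rw [hτ, ← map_mul, inv_mul_cancel₀ ht, map_one]
  have hsq : e * e * (τ ^ 2 * y ^ 2) = 1 := by
    have h1 : nilBinom (m + 1) x (t ^ 2) ((1 : ℕ) : ℂ) = τ ^ 2 * y ^ 2 := by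
      rw [nilBinom_natCast hx, pow_one, Algebra.smul_def, ← inv_pow, map_pow, ← hτ, hx_def, map_pow]
      linear_combination -(τ * algebraMap ℂ B t + 1) * hτt
    rw [← h1, he, ← nilBinom_add hx, ← nilBinom_add hx,
      show (-1 / 2 + -1 / 2 + ((1 : ℕ) : ℂ)) = ((0 : ℕ) : ℂ) by norm_num, nilBinom_natCast hx,
      pow_zero]
  rw [Algebra.smul_def, ← hτ]
  have hnil : IsNilpotent (y * (τ * e) - 1) := by
    have : y * (τ * e) - 1 = (y - algebraMap ℂ B t) * (τ * e) + (e - 1) := by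
      linear_combination e * hτt
    rw [this]
    exact Commute.isNilpotent_add (Commute.all _ _)
      (Commute.isNilpotent_mul_right (Commute.all _ _) ⟨m + 1, hy⟩)
      (isNilpotent_nilBinom_sub_one hx _ _)
  -- The element `v = y τ e` satisfies `v² = 1` with `v - 1` nilpotent. Hence `v + 1 = (v - 1) + 2`
  -- is a unit, and `(v + 1)(v - 1) = 0` selects the root `v = 1`.
  have hunit : IsUnit (y * (τ * e) - 1 + algebraMap ℂ B 2) :=
    hnil.isUnit_add_right_of_commute ((isUnit_iff_ne_zero.mpr two_ne_zero).map _) (Commute.all _ _)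
  have h0 : (y * (τ * e) - 1 + algebraMap ℂ B 2) * (y * (τ * e) - 1) = 0 := by
    rw [map_ofNat]
    linear_combination hsq
  exact sub_eq_zero.mp (hunit.mul_right_eq_zero.mp h0)

end Nilpotent

/-! ### Binomial coefficients at half-integers -/

theorem choose_succ_mul_succ (r : ℂ) (k : ℕ) :
    Ring.choose r (k + 1) * (k + 1) = Ring.choose r k * (r - k) := by
  have h : ((k : ℂ) + 1) ≠ 0 := Nat.cast_add_one_ne_zero k
  have hk : (k.factorial : ℂ) ≠ 0 := Nat.cast_ne_zero.mpr k.factorial_ne_zero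
  rw [Ring.choose_eq_smul, Ring.choose_eq_smul, descPochhammer_succ_right, Nat.factorial_succ]
  simp only [Polynomial.smeval_mul, Polynomial.smeval_sub, Polynomial.smeval_X,
    Polynomial.smeval_natCast, smul_eq_mul, Nat.cast_mul, Nat.cast_succ, pow_one, pow_zero,
    nsmul_eq_mul, mul_one]
  field_simp

theorem choose_half_integer_self (a : ℕ) :
    Ring.choose ((a : ℂ) - 1 / 2) a * (4 ^ a * a.factorial * a.factorial) =
      ((2 * a).factorial : ℂ) := by
  induction a with
  | zero => simp
  | succ a ih =>
    have h1 := choose_succ_mul_succ ((a : ℂ) - 1 / 2) a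
    have h2 := Ring.choose_succ_succ ((a : ℂ) - 1 / 2) a
    rw [show ((a + 1 : ℕ) : ℂ) - 1 / 2 = (a : ℂ) - 1 / 2 + 1 by push_cast; ring, h2,
      show 2 * (a + 1) = 2 * a + 1 + 1 by ring]
    simp only [Nat.factorial_succ, pow_succ]
    push_cast
    rw [← ih]
    linear_combination (4 * (4 : ℂ) ^ a * a.factorial ^ 2 * (a + 1)) * h1

/-- Each step in `b` multiplies the binomial coefficient by `-(b + 1/2) / (a + b + 1)`, which
accounts for the sign and the growth of `(2b)!`. -/
theorem choose_half_integer (a b : ℕ) :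
    Ring.choose ((a : ℂ) - 1 / 2) (a + b) *
      ((-1) ^ b * 4 ^ (a + b) * (a + b).factorial * a.factorial * b.factorial) =
      ((2 * a).factorial : ℂ) * (2 * b).factorial := by
  induction b with
  | zero => simpa [mul_assoc] using choose_half_integer_self a
  | succ b ih =>
    have h1 := choose_succ_mul_succ ((a : ℂ) - 1 / 2) (a + b)
    rw [← add_assoc, show 2 * (b + 1) = 2 * b + 1 + 1 by ring]
    simp only [Nat.factorial_succ, pow_succ]
    push_cast at h1 ⊢
    linear_combination (2 * b + 1) * (2 * b + 2) * ih -
      (4 * (-1) ^ b * (4 : ℂ) ^ (a + b) * (a + b).factorial * a.factorial * b.factorial *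
        (b + 1)) * h1

/-! ### Expansion of `1` in odd powers -/

section Span

variable {B : Type*} [CommRing B] [Algebra ℂ B]

/-- The span of the odd powers `z, z ^ 3, …, z ^ (2 K - 1)`. -/
def oddSpan (z : B) (K : ℕ) : Submodule ℂ B :=
  Submodule.span ℂ ((fun k => z ^ (2 * k + 1)) '' Set.Iio K)

theorem pow_mem_oddSpan (z : B) {K k e : ℕ} (he : e = 2 * k + 1) (hk : k < K) :
    z ^ e ∈ oddSpan z K :=
  he ▸ Submodule.subset_span ⟨k, hk, rfl⟩

theorem pow_mul_natCast_mem_oddSpan (z : B) {K k e : ℕ} (c : ℕ) (he : e = 2 * k + 1) (hk : k < K) :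
    z ^ e * (c : B) ∈ oddSpan z K := by
  rw [mul_comm, ← nsmul_eq_mul]
  exact Submodule.smul_of_tower_mem _ c (pow_mem_oddSpan z he hk)

/-- The exponents run in steps of two from `2m + 1 - 2j` to `2m + 1 + 2j`, within `[1, 4m + 1]`. -/
theorem odd_pow_mul_sq_pow_mem_oddSpan {z z' : B} (hz : z * z' = 1) {m j : ℕ} (hj : j ≤ m) :
    z ^ (2 * m + 1) * ((z + z') ^ 2) ^ j ∈ oddSpan z (2 * m + 1) := by
  rw [← pow_mul, pow_mul_add_inv_pow hz (by omega)]
  refine Submodule.sum_mem _ fun i hi => ?_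
  rw [Finset.mem_range] at hi
  exact pow_mul_natCast_mem_oddSpan z _ (k := m - j + i) (by omega) (by omega)

theorem even_pow_mul_sq_pow_mem_oddSpan {z z' : B} (hz : z * z' = 1) {m j : ℕ} (hj : j < m) :
    z ^ (2 * m + 2) * ((z + z') * ((z + z') ^ 2) ^ j) ∈ oddSpan z (2 * m + 1) := by
  rw [← pow_mul, ← pow_succ', pow_mul_add_inv_pow hz (by omega)]
  refine Submodule.sum_mem _ fun i hi => ?_
  rw [Finset.mem_range] at hi
  exact pow_mul_natCast_mem_oddSpan z _ (k := m - j + i) (by omega) (by omega)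

theorem even_pow_mul_sq_pow_sub_mem_oddSpan {z z' : B} (hz : z * z' = 1) (m : ℕ) :
    z ^ (2 * m + 2) * ((z + z') * ((z + z') ^ 2) ^ m) - z ^ (4 * m + 3) ∈
      oddSpan z (2 * m + 1) := by
  rw [← pow_mul, ← pow_succ', pow_mul_add_inv_pow hz (by omega), Finset.sum_range_succ,
    Nat.choose_self, Nat.cast_one, mul_one,
    show 2 * m + 2 - (2 * m + 1) + 2 * (2 * m + 1) = 4 * m + 3 by omega, add_sub_cancel_right]
  refine Submodule.sum_mem _ fun i hi => ?_
  rw [Finset.mem_range] at hi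
  exact pow_mul_natCast_mem_oddSpan z _ (k := i) (by omega) (by omega)

theorem even_pow_mul_shifted_pow_mem_oddSpan {z z' : B} (hz : z * z' = 1) {m i : ℕ} (hi : i < m)
    (T : ℂ) : z ^ (2 * m + 2) * ((z + z') * ((z + z') ^ 2 - algebraMap ℂ B T) ^ i) ∈
      oddSpan z (2 * m + 1) := by
  rw [sub_eq_add_neg, add_pow, Finset.mul_sum, Finset.mul_sum]
  refine Submodule.sum_mem _ fun j hj => ?_
  rw [Finset.mem_range] at hj
  have := Submodule.smul_mem _ ((-T) ^ (i - j) * (i.choose j : ℂ))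
    (even_pow_mul_sq_pow_mem_oddSpan hz (show j < m by omega))
  convert this using 1
  rw [Algebra.smul_def, map_mul, map_pow, map_neg, map_natCast]
  ring

theorem even_pow_mul_shifted_pow_sub_mem_oddSpan {z z' : B} (hz : z * z' = 1) (m : ℕ) (T : ℂ) :
    z ^ (2 * m + 2) * ((z + z') * ((z + z') ^ 2 - algebraMap ℂ B T) ^ m) - z ^ (4 * m + 3) ∈
      oddSpan z (2 * m + 1) := by
  rw [sub_eq_add_neg ((z + z') ^ 2), add_pow, Finset.sum_range_succ, mul_add, mul_add,
    add_sub_assoc, Finset.mul_sum, Finset.mul_sum]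
  refine Submodule.add_mem _ (Submodule.sum_mem _ fun j hj => ?_) ?_
  · rw [Finset.mem_range] at hj
    have := Submodule.smul_mem _ ((-T) ^ (m - j) * (m.choose j : ℂ))
      (even_pow_mul_sq_pow_mem_oddSpan hz hj)
    convert this using 1
    rw [Algebra.smul_def, map_mul, map_pow, map_neg, map_natCast]
    ring
  · simpa using even_pow_mul_sq_pow_sub_mem_oddSpan hz m

/-- Only the term of order `m` in the truncated series reaches `z ^ (4m+3)`. -/
theorem even_pow_mul_nilBinom_sub_mem_oddSpan {z z' : B} (hz : z * z' = 1) (m : ℕ) (T r : ℂ) :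
    z ^ (2 * m + 2) * ((z + z') *
        nilBinom (m + 1) ((z + z') ^ 2 - algebraMap ℂ B T) T r) -
      (Ring.choose r m * (T⁻¹) ^ m) • z ^ (4 * m + 3) ∈ oddSpan z (2 * m + 1) := by
  rw [nilBinom_eq_sum, Finset.sum_range_succ, mul_add, mul_add, add_sub_assoc, Finset.mul_sum,
    Finset.mul_sum]
  refine Submodule.add_mem _ (Submodule.sum_mem _ fun i hi => ?_) ?_
  · rw [mul_smul_comm, mul_smul_comm]
    exact Submodule.smul_mem _ _
      (even_pow_mul_shifted_pow_mem_oddSpan hz (Finset.mem_range.mp hi) T)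
  · rw [mul_smul_comm, mul_smul_comm, ← smul_sub]
    exact Submodule.smul_mem _ _ (even_pow_mul_shifted_pow_sub_mem_oddSpan hz m T)

/-- Reducing `p` modulo `(X - T) ^ (m+1)` brings its degree down to at most `m`. -/
theorem odd_pow_mul_aeval_mem_oddSpan {z z' : B} (hz : z * z' = 1) (m : ℕ) (T : ℂ)
    (hT : ((z + z') ^ 2 - algebraMap ℂ B T) ^ (m + 1) = 0) (p : Polynomial ℂ) :
    z ^ (2 * m + 1) * Polynomial.aeval ((z + z') ^ 2) p ∈ oddSpan z (2 * m + 1) := by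
  have hmonic : ((Polynomial.X - Polynomial.C T) ^ (m + 1)).Monic :=
    (Polynomial.monic_X_sub_C T).pow _
  have hdeg : ((Polynomial.X - Polynomial.C T) ^ (m + 1)).natDegree = m + 1 := by simp
  have hlt : (p %ₘ (Polynomial.X - Polynomial.C T) ^ (m + 1)).natDegree < m + 1 := by
    conv_rhs => rw [← hdeg]
    refine Polynomial.natDegree_modByMonic_lt p hmonic fun h => ?_
    rw [h, Polynomial.natDegree_one] at hdeg
    omega
  have hp : Polynomial.aeval ((z + z') ^ 2) p =
      Polynomial.aeval ((z + z') ^ 2) (p %ₘ (Polynomial.X - Polynomial.C T) ^ (m + 1)) := by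
    conv_lhs => rw [← Polynomial.modByMonic_add_div p ((Polynomial.X - Polynomial.C T) ^ (m + 1))]
    simp [hT]
  rw [hp, Polynomial.aeval_eq_sum_range' hlt, Finset.mul_sum]
  refine Submodule.sum_mem _ fun j hj => ?_
  rw [mul_smul_comm]
  exact Submodule.smul_mem _ _
    (odd_pow_mul_sq_pow_mem_oddSpan hz (Nat.lt_succ_iff.mp (Finset.mem_range.mp hj)))

/-- The coefficient of `z ^ (4 m + 3)` when `-1` is expanded in the odd powers
`z, …, z ^ (4 m + 3)`, where `(z + z⁻¹ - t) ^ (m + 1) = 0`. -/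
noncomputable def topCoeff (m : ℕ) (t : ℂ) : ℂ :=
  ∑ k ∈ Finset.range (m + 1), (-1) ^ k * ((2 * m - k).choose k : ℂ) *
    Ring.choose (((m - k : ℕ) : ℂ) - 1 / 2) m * (t⁻¹) ^ (2 * k + 1)

theorem one_add_topCoeff_smul_mem_oddSpan {z z' : B} (hz : z * z' = 1) (m : ℕ) {t : ℂ}
    (ht : t ≠ 0) (hy : (z + z' - algebraMap ℂ B t) ^ (m + 1) = 0) :
    1 + topCoeff m t • z ^ (4 * m + 3) ∈ oddSpan z (2 * m + 1) := by
  set y := z + z' with hy_def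
  set x := y ^ 2 - algebraMap ℂ B (t ^ 2) with hx_def
  have hx : x ^ (m + 1) = 0 := by
    have : x = (y - algebraMap ℂ B t) * (y + algebraMap ℂ B t) := by
      rw [hx_def, map_pow]; ring
    rw [this, mul_pow, hy, zero_mul]
  have hinv := mul_nilBinom_neg_half_eq_one ht hy
  rw [← hx_def] at hinv
  have hone : z ^ (2 * m + 1) * signedFib y (2 * m + 1) -
      z ^ (2 * m + 2) * signedFib y (2 * m) = 1 := by
    have h1 := inv_pow_eq_signedFib hz (2 * m)
    have h2 : z ^ (2 * m + 2) * z' ^ (2 * m + 2) = 1 := by rw [← mul_pow, hz, one_pow]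
    rw [h1] at h2
    linear_combination h2 - z ^ (2 * m + 1) * signedFib y (2 * m + 1) * hz
  -- As `y⁻¹ = r(y²)`, also `y = y² r(y²)` is a polynomial in `y²`, which corrects the parity of the
  -- odd-index polynomial.
  have hodd : z ^ (2 * m + 1) * signedFib y (2 * m + 1) ∈ oddSpan z (2 * m + 1) := by
    obtain ⟨-, p, hp⟩ := exists_signedFib_eq_aeval_sq y m
    obtain ⟨r, hr⟩ : ∃ r : Polynomial ℂ,
        t⁻¹ • nilBinom (m + 1) x (t ^ 2) (-1 / 2) = Polynomial.aeval (y ^ 2) r := by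
      have h : x = Polynomial.aeval (y ^ 2) (Polynomial.X - Polynomial.C (t ^ 2)) := by
        simp [hx_def]
      rw [nilBinom, evalTrunc, h, ← Polynomial.aeval_comp, ← map_smul]
      exact ⟨_, rfl⟩
    rw [hr] at hinv
    have : signedFib y (2 * m + 1) = Polynomial.aeval (y ^ 2) (Polynomial.X * p * r) := by
      rw [hp, map_mul, map_mul, Polynomial.aeval_X]
      linear_combination -(y * Polynomial.aeval (y ^ 2) p) * hinv
    rw [this]
    exact odd_pow_mul_aeval_mem_oddSpan hz m (t ^ 2) hx _
  have heven : z ^ (2 * m + 2) * signedFib y (2 * m) - topCoeff m t • z ^ (4 * m + 3) ∈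
      oddSpan z (2 * m + 1) := by
    -- Inserting `y y⁻¹ = 1` leaves an outer factor `y`; the power `(y²) ^ (m - k)` merges with
    -- `y⁻¹` into the exponent `m - k - 1/2`.
    have hfib : signedFib y (2 * m) = ∑ k ∈ Finset.range (m + 1),
        ((-1) ^ k * ((2 * m - k).choose k : ℂ) * t⁻¹ * (t ^ 2) ^ (m - k)) •
          (y * nilBinom (m + 1) x (t ^ 2) (((m - k : ℕ) : ℂ) - 1 / 2)) := by
      rw [← mul_one (signedFib y (2 * m)), ← hinv, signedFib_two_mul, Finset.sum_mul]
      refine Finset.sum_congr rfl fun k _ => ?_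
      have hpow : y ^ 2 = algebraMap ℂ B (t ^ 2) * (1 + (t ^ 2)⁻¹ • x) := by
        rw [Algebra.smul_def, mul_add, ← mul_assoc, ← map_mul,
          mul_inv_cancel₀ (pow_ne_zero 2 ht), map_one, hx_def]
        ring
      have hadd : nilBinom (m + 1) x (t ^ 2) (((m - k : ℕ) : ℂ) - 1 / 2) =
          (1 + (t ^ 2)⁻¹ • x) ^ (m - k) * nilBinom (m + 1) x (t ^ 2) (-1 / 2) := by
        rw [← nilBinom_natCast hx, ← nilBinom_add hx]
        congr 1
        ring
      rw [hadd, hpow, mul_pow]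
      simp only [Algebra.smul_def, map_mul, map_pow, map_neg, map_one, map_natCast]
      ring
    rw [hfib, topCoeff, Finset.mul_sum, Finset.sum_smul, ← Finset.sum_sub_distrib]
    refine Submodule.sum_mem _ fun k hk => ?_
    have hk : k ≤ m := Nat.lt_succ_iff.mp (Finset.mem_range.mp hk)
    have h := Submodule.smul_mem _ ((-1) ^ k * ((2 * m - k).choose k : ℂ) * t⁻¹ *
      (t ^ 2) ^ (m - k)) (even_pow_mul_nilBinom_sub_mem_oddSpan hz m (t ^ 2)
        (((m - k : ℕ) : ℂ) - 1 / 2))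
    rw [← hy_def, ← hx_def] at h
    convert h using 1
    rw [smul_sub, mul_smul_comm, smul_smul]
    congr 2
    have : (t ^ 2) ^ (m - k) * ((t ^ 2)⁻¹) ^ m = (t⁻¹) ^ (2 * k) := by
      obtain ⟨d, rfl⟩ := Nat.exists_eq_add_of_le hk
      rw [Nat.add_sub_cancel_left]
      calc (t ^ 2) ^ d * ((t ^ 2)⁻¹) ^ (k + d) = (t * t⁻¹) ^ (2 * d) * (t⁻¹) ^ (2 * k) := by ring
        _ = _ := by rw [mul_inv_cancel₀ ht, one_pow, one_mul]
    rw [pow_succ, ← this]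
    ring
  have := Submodule.sub_mem _ hodd heven
  convert this using 1
  rw [← hone]
  ring

end Span

/-! ### Closed form of the coefficient -/

theorem topCoeff_eq (m : ℕ) (t : ℂ) :
    topCoeff m t = ((2 : ℂ) ^ (2 * m))⁻¹ * ∑ k ∈ Finset.range (m + 1),
      ((2 * k).choose k : ℂ) * ((2 * m - k).choose m : ℂ) * (1 / t ^ (2 * k + 1)) := by
  rw [topCoeff, Finset.mul_sum]
  refine Finset.sum_congr rfl fun k hk => ?_
  obtain ⟨a, rfl⟩ := Nat.exists_eq_add_of_le (Nat.lt_succ_iff.mp (Finset.mem_range.mp hk))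
  have h := choose_half_integer a k
  have h1 : (((2 * a + k).choose k : ℕ) : ℂ) * k.factorial * (2 * a).factorial =
      (2 * a + k).factorial := by
    have := Nat.choose_mul_factorial_mul_factorial (show k ≤ 2 * a + k by omega)
    rw [Nat.add_sub_cancel] at this
    exact_mod_cast this
  have h2 : (((2 * a + k).choose (k + a) : ℕ) : ℂ) * (k + a).factorial * a.factorial =
      (2 * a + k).factorial := by
    have := Nat.choose_mul_factorial_mul_factorial (show k + a ≤ 2 * a + k by omega)
    rw [show 2 * a + k - (k + a) = a by omega] at this
    exact_mod_cast this
  have h3 : (((2 * k).choose k : ℕ) : ℂ) * k.factorial * k.factorial = (2 * k).factorial := by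
    have := Nat.choose_mul_factorial_mul_factorial (show k ≤ 2 * k by omega)
    rw [show 2 * k - k = k by omega] at this
    exact_mod_cast this
  rw [show 2 * (k + a) - k = 2 * a + k by omega, Nat.add_sub_cancel_left, one_div (t ^ _), inv_pow,
    ← mul_assoc]
  congr 1
  rw [eq_inv_mul_iff_mul_eq₀ (pow_ne_zero _ two_ne_zero), pow_mul,
    show (2 : ℂ) ^ 2 = 4 by norm_num]
  have hne : ∀ i : ℕ, (i.factorial : ℂ) ≠ 0 := fun i => Nat.cast_ne_zero.mpr i.factorial_ne_zero
  rw [add_comm a k] at h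
  have hsign : ((-1 : ℂ) ^ k) * (-1) ^ k = 1 := by rw [← mul_pow]; simp
  apply mul_right_cancel₀ (mul_ne_zero (mul_ne_zero (mul_ne_zero (mul_ne_zero (hne (k + a))
    (hne a)) (hne k)) (hne k)) (hne (2 * a)))
  calc _ = (((2 * a + k).choose k : ℕ) : ℂ) * k.factorial * (2 * a).factorial *
        (Ring.choose ((a : ℂ) - 1 / 2) (k + a) *
          ((-1) ^ k * 4 ^ (k + a) * (k + a).factorial * a.factorial * k.factorial)) := by ring
    _ = _ := by
      rw [h, h1, ← h2, ← h3]
      ring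

/-! ### The ratio of determinants at the given tuple -/

theorem nodePoly_quarticTuple (m : ℕ) {w : ℂ} (hw : w ≠ 0) :
    nodePoly (quarticTuple m w) =
      (Polynomial.X ^ 2 - Polynomial.C (w + w⁻¹) * Polynomial.X + 1) ^ (m + 1) := by
  have h : (Polynomial.X ^ 2 - Polynomial.C (w + w⁻¹) * Polynomial.X + 1 : Polynomial ℂ) =
      (Polynomial.X - Polynomial.C w) * (Polynomial.X - Polynomial.C w⁻¹) := by
    have : (Polynomial.C w * Polynomial.C w⁻¹ : Polynomial ℂ) = 1 := by
      rw [← Polynomial.C_mul, mul_inv_cancel₀ hw, Polynomial.C_1]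
    rw [Polynomial.C_add]
    linear_combination -this
  rw [h, mul_pow, nodePoly]
  simp only [quarticTuple]
  rw [Fin.prod_univ_eq_prod_range (fun i => (Polynomial.X - Polynomial.C
    (if i < m + 1 then w else w⁻¹) : Polynomial ℂ)), show 2 * m + 2 = (m + 1) + (m + 1) by ring,
    Finset.prod_range_add]
  congr 1
  · rw [Finset.prod_congr rfl fun i hi => by rw [if_pos (Finset.mem_range.mp hi)]]
    simp
  · rw [Finset.prod_congr rfl fun i _ => by rw [if_neg (by omega)]]
    simp

theorem det_staircase_eq_mul {B : Type*} [CommRing B] [Algebra ℂ B] (m : ℕ)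
    (ψ : B →ₗ[ℂ] (Fin (2 * m + 2) → ℂ)) (z : B) (r : ℂ)
    (h : 1 + r • z ^ (4 * m + 3) ∈ oddSpan z (2 * m + 1)) :
    (Matrix.of fun j => ψ (z ^ (staircase (2 * m + 2) (2 * m + 1) +
      staircase (2 * m + 2) (2 * m + 2)) j)).det =
      r * (Matrix.of fun j => ψ (z ^ (staircase (2 * m + 2) (2 * m + 3) +
        staircase (2 * m + 2) (2 * m + 2)) j)).det := by
  set E : Matrix (Fin (2 * m + 2)) (Fin (2 * m + 2)) ℂ := Matrix.of fun j =>
    ψ (z ^ (staircase (2 * m + 2) (2 * m + 3) + staircase (2 * m + 2) (2 * m + 2)) j) with hE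
  have hrow : ∀ (j : Fin (2 * m + 2)) (e : ℕ), e + 2 * j = 4 * m + 3 → E j = ψ (z ^ e) := by
    intro j e he
    have : (staircase (2 * m + 2) (2 * m + 3) + staircase (2 * m + 2) (2 * m + 2)) j = e := by
      have := j.2
      simp only [staircase, Pi.add_apply]
      omega
    rw [← this]
    rfl
  -- `L` replaces the row of `z ^ (4m+3)` by that of its argument. It kills every lower odd power,
  -- because that row already occurs.
  let L : B →ₗ[ℂ] ℂ := (Matrix.detRowAlternating.toMultilinearMap.toLinearMap E 0).comp ψ
  have hL : ∀ x, L x = (E.updateRow 0 (ψ x)).det := fun x => rfl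
  have hker : oddSpan z (2 * m + 1) ≤ LinearMap.ker L := by
    rw [oddSpan, Submodule.span_le]
    rintro _ ⟨k, hk, rfl⟩
    rw [Set.mem_Iio] at hk
    rw [SetLike.mem_coe, LinearMap.mem_ker, hL]
    have hj : (0 : Fin (2 * m + 2)) ≠ ⟨2 * m + 1 - k, by omega⟩ := by
      rw [Ne, Fin.ext_iff]
      simp only [Fin.val_zero]
      omega
    refine Matrix.det_zero_of_row_eq hj ?_
    rw [Matrix.updateRow_self, Matrix.updateRow_ne hj.symm]
    exact (hrow _ _ (by dsimp only; omega)).symm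
  have h0 := hker h
  have htop : L (z ^ (4 * m + 3)) = E.det := by
    rw [hL, ← hrow 0 (4 * m + 3) (by simp), Matrix.updateRow_eq_self]
  rw [LinearMap.mem_ker, map_add, map_smul, htop, hL, smul_eq_mul] at h0
  -- The exponent `0` stands last, so the row of `1` has to move from the top to the bottom: a cycle
  -- of even length `2m + 2`, hence of sign `-1`.
  have hrot : (Matrix.of fun j => ψ (z ^ (staircase (2 * m + 2) (2 * m + 1) +
      staircase (2 * m + 2) (2 * m + 2)) j)) =
      (E.updateRow 0 (ψ 1)).submatrix (finRotate (2 * m + 1 + 1)) id := by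
    ext j k
    rw [Matrix.submatrix_apply, id, Matrix.of_apply]
    rcases Fin.eq_castSucc_or_eq_last j with ⟨i, rfl⟩ | rfl
    · have hi := i.2
      have hsucc : finRotate (2 * m + 1 + 1) i.castSucc = i.succ := by
        rw [finRotate_apply, Fin.coeSucc_eq_succ]
      rw [hsucc, Matrix.updateRow_ne (Fin.succ_ne_zero i), hrow i.succ]
      simp only [staircase, Pi.add_apply, Fin.val_castSucc, Fin.val_succ]
      omega
    · have : (staircase (2 * m + 2) (2 * m + 1) + staircase (2 * m + 2) (2 * m + 2))
          (Fin.last (2 * m + 1)) = 0 := by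
        simp only [staircase, Pi.add_apply, Fin.val_last]
        omega
      rw [finRotate_last, Matrix.updateRow_self, this, pow_zero]
  rw [hrot, Matrix.det_permute, sign_finRotate,
    show 2 * m + 2 - 1 = 2 * m + 1 by omega, Odd.neg_one_pow ⟨m, rfl⟩]
  push_cast
  linear_combination -h0

/-- If `1 + r z ^ (4 m + 3)` is a combination of lower odd powers of `z` modulo `∏ (X - q_i)`, then
`r` is a ratio of determinants of remainders. -/
theorem det_powRemMatrix_eq_mul (m : ℕ) (q : Fin (2 * m + 2) → ℂ) (r : ℂ)
    (h : 1 + r • AdjoinRoot.root (nodePoly q) ^ (4 * m + 3) ∈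
      oddSpan (AdjoinRoot.root (nodePoly q)) (2 * m + 1)) :
    (powRemMatrix q (staircase (2 * m + 2) (2 * m + 1) + staircase (2 * m + 2) (2 * m + 2))).det =
      r * (powRemMatrix q
        (staircase (2 * m + 2) (2 * m + 3) + staircase (2 * m + 2) (2 * m + 2))).det := by
  let ψ : AdjoinRoot (nodePoly q) →ₗ[ℂ] (Fin (2 * m + 2) → ℂ) :=
    LinearMap.pi fun k => (Polynomial.lcoeff ℂ k).comp (AdjoinRoot.modByMonicHom (nodePoly_monic q))
  have hψ : ∀ e, powRemMatrix q e =
      Matrix.of fun j => ψ (AdjoinRoot.root (nodePoly q) ^ e j) := by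
    intro e
    ext j k
    simp only [powRemMatrix, Matrix.of_apply, ψ, LinearMap.pi_apply, LinearMap.comp_apply,
      Polynomial.lcoeff_apply]
    rw [← AdjoinRoot.mk_X, ← map_pow, AdjoinRoot.modByMonicHom_mk]
  rw [hψ, hψ]
  exact det_staircase_eq_mul m ψ _ r h

theorem one_add_topCoeff_smul_root_mem_oddSpan (m : ℕ) {w : ℂ} (hw : w ≠ 0) (hw' : w + w⁻¹ ≠ 0) :
    1 + topCoeff m (w + w⁻¹) •
        AdjoinRoot.root (nodePoly (quarticTuple m w)) ^ (4 * m + 3) ∈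
      oddSpan (AdjoinRoot.root (nodePoly (quarticTuple m w))) (2 * m + 1) := by
  set z := AdjoinRoot.root (nodePoly (quarticTuple m w)) with hz
  set τ := algebraMap ℂ (AdjoinRoot (nodePoly (quarticTuple m w))) (w + w⁻¹) with hτ
  have hroot : (z ^ 2 - τ * z + 1) ^ (m + 1) = 0 := by
    have h := congrArg (Polynomial.aeval z) (nodePoly_quarticTuple m hw)
    rw [hz, AdjoinRoot.aeval_eq, AdjoinRoot.mk_self, ← hz] at h
    simpa [hτ] using h.symm
  -- `z (τ - z)` differs from `1` by a nilpotent, which makes `z` invertible.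
  have hunit : IsUnit (z * (τ - z)) := by
    have h : IsNilpotent (-(z ^ 2 - τ * z + 1)) := IsNilpotent.neg ⟨_, hroot⟩
    have := h.isUnit_add_one
    convert this using 1
    ring
  obtain ⟨z', hz'⟩ := (isUnit_of_mul_isUnit_left hunit).exists_right_inv
  refine one_add_topCoeff_smul_mem_oddSpan hz' m hw' ?_
  have : z + z' - τ = z' * (z ^ 2 - τ * z + 1) := by
    linear_combination (τ - z) * hz'
  rw [← hτ, this, mul_pow, hroot, mul_zero]

theorem mainTheorem4 (m : ℕ) (w : ℂ) (hw : w ≠ 0) (hw' : w + w⁻¹ ≠ 0) :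
    schur (staircase (2 * m + 2) (2 * m + 3)) (quarticTuple m w) ≠ 0 ∧
    schur (staircase (2 * m + 2) (2 * m + 1)) (quarticTuple m w) /
        schur (staircase (2 * m + 2) (2 * m + 3)) (quarticTuple m w) =
      ((2 : ℂ) ^ (2 * m))⁻¹ *
        ∑ k ∈ Finset.range (m + 1),
          ((2 * k).choose k : ℂ) * ((2 * m - k).choose m : ℂ) *
            (1 / (w + w⁻¹) ^ (2 * k + 1)) := by
  have hne : schur (staircase (2 * m + 2) (2 * m + 3)) (quarticTuple m w) ≠ 0 := by
    apply schur_staircase_succ_ne_zero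
    · intro i
      unfold quarticTuple
      split_ifs
      exacts [hw, inv_ne_zero hw]
    · intro i j
      unfold quarticTuple
      split_ifs
      · simpa [← two_mul] using hw
      · exact hw'
      · rwa [add_comm]
      · simpa [← two_mul] using hw
  refine ⟨hne, ?_⟩
  obtain ⟨c, hc, hdet⟩ := exists_schur_mul_eq_det_powRemMatrix (quarticTuple m w)
  rw [← topCoeff_eq, div_eq_iff hne]
  apply mul_right_cancel₀ hc
  rw [mul_assoc, hdet, hdet]
  exact det_powRemMatrix_eq_mul m _ _ (one_add_topCoeff_smul_root_mem_oddSpan m hw hw')
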